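/- **Notation.** Let $\tau$ be in the upper half-plane, let $\theta_j(\cdot)=\theta_j(\cdot\,|\,\tau)$ be the Jacobi theta functions, and let $\mathrm{sn},\mathrm{cn},\mathrm{dn}$ be the Jacobi elliptic functions of modulus $k=\theta_2(0)^2/\theta_3(0)^2$ (every $k\in\mathbb C\setminus\{0,1,-1\}$ is of this form). Fix a square root $\sqrt k$ and $\alpha_0,\beta_0,\phi\in\mathbb C$, and put $\alpha_n=\alpha_0+n\phi$, $\beta_m=\beta_0-m\phi$ for $n,m\in\mathbb Z$. Let $$Q_{a,b}(w,x,y,z)=\mathrm{sn}(a)(wx+yz)-\mathrm{sn}(b)(wy+xz)-\mathrm{sn}(a-b)\bigl[xy+wz-k\,\mathrm{sn}(a)\,\mathrm{sn}(b)(1+wxyz)\bigr].$$ The *constrained lattice system* for $v:\mathbb Z^2\to\mathbb C$ consists of $$Q_{\alpha_n,\beta_m}(v_{n,m},v_{n+1,m},v_{n,m+1},v_{n+1,m+1})=0\qquad(n,m\in\mathbb Z)\tag{1}$$ and the diagonal constraint $$v_{n,n+1}=v_{n+1,n},\qquad v_{n,n}=v_{n-1,n+1}\qquad(n\in\mathbb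 Z).\tag{2}$$ For $u:\mathbb Z\to\mathbb C$ consider the second-order equation $$\begin{aligned}&\mathrm{cn}(\gamma_n)\mathrm{dn}(\gamma_n)\bigl(1-k^2\mathrm{sn}^4(z_n)\bigr)u_n(u_{n+1}+u_{n-1})\\&-\mathrm{cn}(z_n)\mathrm{dn}(z_n)\bigl(1-k^2\mathrm{sn}^2(z_n)\mathrm{sn}^2(\gamma_n)\bigr)(u_{n+1}u_{n-1}+u_n^2)\\&+\bigl(\mathrm{cn}^2(z_n)-\mathrm{cn}^2(\gamma_n)\bigr)\mathrm{cn}(z_n)\mathrm{dn}(z_n)\bigl(1+k^2u_n^2u_{n+1}u_{n-1}\bigr)=0,\end{aligned}\tag{3}$$ where $z_n=(\gamma_e+\gamma_o)n+z_0$, $\gamma_n=\gamma_e$ for even $n$, $\gamma_n=\gamma_o$ for odd $n$, and $$z_0=\tfrac12(\alpha_0-\beta_0),\qquad \gamma_e=\tfrac12(\alpha_0+\beta_0),\qquad \gamma_o=\tfrac12(\phi-\alpha_0-\beta_0).\tag{4}$$ The variables on the diagonal path are identified by $$(u_{2n-1},u_{2n})=\Bigl(\frac{v_{n,n}}{\sqrt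 k},\frac{v_{n,n+1}}{\sqrt k}\Bigr)\qquad(n\in\mathbb Z).\tag{5}$$ A system of equations for a family of complex unknowns *has two degrees of freedom*, with two of the unknowns as initial data, if there are countably many nonzero polynomials in $\mathbb C[x,y]$ such that for every $(x,y)\in\mathbb C^2$ at which none of them vanishes there is exactly one solution whose initial data are $(x,y)$, and each unknown of this solution is given by a rational function of $(x,y)$, the same for all such $(x,y)$. *Generic* below means: off the zero sets of countably many nonzero polynomials in two variables. Assume that none of $\alpha_n$, $\beta_m$, $\alpha_n-\beta_m$ ($n,m\in\mathbb Z$) is a pole of $\mathrm{sn}$. Call the parameters *nondegenerate* if $\mathrm{sn}(\alpha_n)$, $\mathrm{sn}(\beta_m)$, $\mathrm{sn}(\alpha_n-\beta_m)$ are nonzero for all $n,m\in\mathbb Z$. **Proposition.** 1. If the parameters are nondegenerate, then the constrained lattice system (1), (2) has two degrees of freedom, with $v_{0,0},v_{0,1}$ as initial data. 2. Suppose that none of $\gamma_e,\gamma_o,z_n$ ($n\in\mathbb Z$) is a pole of $\mathrm{sn}$ and that $\mathrm{sn}(z_n)\ne0$ for all $n\in\mathbb Z$. Then on the variables $v_{n,n},v_{n,n+1}$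 the constrained lattice system coincides with (3) under the identifications (4), (5): - for every solution $v$ of (1), (2) the sequence $u$ of (5) solves (3); - for every $v$ that satisfies (2) and every $n$, equation (1) on the square with lower left corner $(n,n)$ is equivalent to (3) at index $2n$, and equation (1) on the square with lower left corner $(n-1,n)$ is equivalent to (3) at index $2n-1$; - if moreover the parameters are nondegenerate, then (3) has two degrees of freedom with $u_{-1},u_0$ as initial data, and every solution $u$ of (3) with generic $(u_{-1},u_0)$ comes by (5) from exactly one solution $v$ of (1), (2). -/

import Mathlib

noncomputable section

namespace Q4Red

open Complex

/-! ### Jacobi theta functions and Jacobi elliptic functions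

The theta functions are written through Mathlib's
`jacobiTheta₂ z τ = ∑ exp (2 π i n z + π i n² τ)`, so that `z` has period one. -/

/-- `θ₁(z|τ) = -i ∑ (-1)ⁿ exp (π i τ (n+1/2)² + (2n+1) π i z)`. -/
def theta1 (τ : UpperHalfPlane) (z : ℂ) : ℂ :=
  -I * exp (Real.pi * I * ((τ : ℂ) / 4 + z)) * jacobiTheta₂ (z + 1 / 2 + (τ : ℂ) / 2) τ

/-- `θ₂(z|τ) = ∑ exp (π i τ (n+1/2)² + (2n+1) π i z)`. -/
def theta2 (τ : UpperHalfPlane) (z : ℂ) : ℂ :=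
  exp (Real.pi * I * ((τ : ℂ) / 4 + z)) * jacobiTheta₂ (z + (τ : ℂ) / 2) τ

/-- `θ₃(z|τ) = ∑ exp (π i τ n² + 2 n π i z)`. -/
def theta3 (τ : UpperHalfPlane) (z : ℂ) : ℂ := jacobiTheta₂ z τ

/-- `θ₄(z|τ) = ∑ (-1)ⁿ exp (π i τ n² + 2 n π i z)`. -/
def theta4 (τ : UpperHalfPlane) (z : ℂ) : ℂ := jacobiTheta₂ (z + 1 / 2) τ

/-- The elliptic modulus `k = θ₂(0)² / θ₃(0)²`. As `τ` runs through the upper half-plane, `k` takes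
every complex value except `0, 1, -1`. -/
def modulus (τ : UpperHalfPlane) : ℂ := theta2 τ 0 ^ 2 / theta3 τ 0 ^ 2

/-- The theta argument `u / (π θ₃(0)²)` that belongs to the elliptic argument `u`. -/
def arg (τ : UpperHalfPlane) (u : ℂ) : ℂ := u / (Real.pi * theta3 τ 0 ^ 2)

/-- Jacobi's `sn(u, k)`, `k = modulus τ`. -/
def sn (τ : UpperHalfPlane) (u : ℂ) : ℂ :=
  theta3 τ 0 / theta2 τ 0 * (theta1 τ (arg τ u) / theta4 τ (arg τ u))

/-- Jacobi's `cn(u, k)`, `k = modulus τ`. -/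
def cn (τ : UpperHalfPlane) (u : ℂ) : ℂ :=
  theta4 τ 0 / theta2 τ 0 * (theta2 τ (arg τ u) / theta4 τ (arg τ u))

/-- Jacobi's `dn(u, k)`, `k = modulus τ`. -/
def dn (τ : UpperHalfPlane) (u : ℂ) : ℂ :=
  theta4 τ 0 / theta3 τ 0 * (theta3 τ (arg τ u) / theta4 τ (arg τ u))

/-- `u` is a pole of `sn`, `cn` and `dn` (these have the same poles, the zeros of `θ₄`). -/
def IsPole (τ : UpperHalfPlane) (u : ℂ) : Prop := theta4 τ (arg τ u) = 0

/-! ### The lattice system -/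

/-- The polynomial `Q_{a,b}(w,x,y,z)` of Q4 in Jacobi form. -/
def Q (τ : UpperHalfPlane) (a b w x y z : ℂ) : ℂ :=
  sn τ a * (w * x + y * z) - sn τ b * (w * y + x * z)
    - sn τ (a - b) * (x * y + w * z - modulus τ * sn τ a * sn τ b * (1 + w * x * y * z))

/-- The lattice parameter `α_n = α₀ + n φ`. -/
def alpha (α₀ φ : ℂ) (n : ℤ) : ℂ := α₀ + n * φ

/-- The lattice parameter `β_m = β₀ - m φ`. -/
def beta (β₀ φ : ℂ) (m : ℤ) : ℂ := β₀ - m * φ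

/-- The Q4 equation on the elementary square with lower left corner `(n, m)`. -/
def QuadEq (τ : UpperHalfPlane) (α₀ β₀ φ : ℂ) (v : ℤ × ℤ → ℂ) (n m : ℤ) : Prop :=
  Q τ (alpha α₀ φ n) (beta β₀ φ m) (v (n, m)) (v (n + 1, m)) (v (n, m + 1)) (v (n + 1, m + 1)) = 0

/-- The constraint along the diagonal. -/
def Ridge (v : ℤ × ℤ → ℂ) : Prop :=
  ∀ n : ℤ, v (n, n + 1) = v (n + 1, n) ∧ v (n, n) = v (n - 1, n + 1)

/-- The solutions of the lattice system that obey the diagonal constraint. -/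
def latticeSolutions (τ : UpperHalfPlane) (α₀ β₀ φ : ℂ) : Set (ℤ × ℤ → ℂ) :=
  {v | (∀ n m : ℤ, QuadEq τ α₀ β₀ φ v n m) ∧ Ridge v}

/-! ### The second-order equation -/

/-- `z_n = (γ_e + γ_o) n + z_0`. -/
def zSeq (γe γo z₀ : ℂ) (n : ℤ) : ℂ := (γe + γo) * n + z₀

/-- `γ_n` is `γ_e` for even `n` and `γ_o` for odd `n`. -/
def gammaSeq (γe γo : ℂ) (n : ℤ) : ℂ := if Even n then γe else γo

/-- The second-order difference equation at `n`. -/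
def RcgEq (τ : UpperHalfPlane) (γe γo z₀ : ℂ) (u : ℤ → ℂ) (n : ℤ) : Prop :=
  let k := modulus τ
  let z := zSeq γe γo z₀ n
  let g := gammaSeq γe γo n
  cn τ g * dn τ g * (1 - k ^ 2 * sn τ z ^ 4) * u n * (u (n + 1) + u (n - 1))
    - cn τ z * dn τ z * (1 - k ^ 2 * sn τ z ^ 2 * sn τ g ^ 2) * (u (n + 1) * u (n - 1) + u n ^ 2)
    + (cn τ z ^ 2 - cn τ g ^ 2) * cn τ z * dn τ z
        * (1 + k ^ 2 * u n ^ 2 * u (n + 1) * u (n - 1)) = 0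

/-- The solutions of the second-order difference equation. -/
def rcgSolutions (τ : UpperHalfPlane) (γe γo z₀ : ℂ) : Set (ℤ → ℂ) :=
  {u | ∀ n : ℤ, RcgEq τ γe γo z₀ u n}

/-! ### The identifications -/

/-- `γ_e = (α₀ + β₀) / 2`. -/
def gammaE (α₀ β₀ : ℂ) : ℂ := (α₀ + β₀) / 2

/-- `γ_o = (φ - α₀ - β₀) / 2`. -/
def gammaO (α₀ β₀ φ : ℂ) : ℂ := (φ - α₀ - β₀) / 2

/-- `z_0 = (α₀ - β₀) / 2`. -/
def zZero (α₀ β₀ : ℂ) : ℂ := (α₀ - β₀) / 2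

/-- The variables on the diagonal path, `u_{2n-1} = v_{n,n} / r` and `u_{2n} = v_{n,n+1} / r`,
where `r` is a square root of the modulus. -/
def pathVar (r : ℂ) (v : ℤ × ℤ → ℂ) (j : ℤ) : ℂ :=
  if Even j then v (j / 2, j / 2 + 1) / r else v ((j + 1) / 2, (j + 1) / 2) / r

/-! ### Conditions on the parameters -/

/-- The coefficients of the lattice system are finite: no argument of `sn` in them is a pole. -/
def LatticeFinite (τ : UpperHalfPlane) (α₀ β₀ φ : ℂ) : Prop :=
  ∀ n m : ℤ, ¬ IsPole τ (alpha α₀ φ n) ∧ ¬ IsPole τ (beta β₀ φ m) ∧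
    ¬ IsPole τ (alpha α₀ φ n - beta β₀ φ m)

/-- No quad polynomial `Q_{α_n, β_m}` of the lattice system degenerates. -/
def LatticeNondegenerate (τ : UpperHalfPlane) (α₀ β₀ φ : ℂ) : Prop :=
  ∀ n m : ℤ, sn τ (alpha α₀ φ n) ≠ 0 ∧ sn τ (beta β₀ φ m) ≠ 0 ∧
    sn τ (alpha α₀ φ n - beta β₀ φ m) ≠ 0

/-- The coefficients of the second-order equation are finite (no argument of `sn`, `cn`, `dn` in
them is a pole), and `sn z_n ≠ 0` for all `n`. -/
def RcgRegular (τ : UpperHalfPlane) (γe γo z₀ : ℂ) : Prop :=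
  ¬ IsPole τ γe ∧ ¬ IsPole τ γo ∧
    ∀ n : ℤ, ¬ IsPole τ (zSeq γe γo z₀ n) ∧ sn τ (zSeq γe γo z₀ n) ≠ 0

/-! ### Two degrees of freedom -/

/-- The point `(x, y)` of the plane lies on none of the countably many curves `E l = 0`. -/
def Avoids (E : ℕ → MvPolynomial (Fin 2) ℂ) (x y : ℂ) : Prop :=
  ∀ l : ℕ, MvPolynomial.eval ![x, y] (E l) ≠ 0

/-- The system with solution set `S` has two degrees of freedom, with the values at the sites `i`
and `j` as initial data: off countably many algebraic curves, the pair `(x, y)` of initial values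
can be prescribed freely, there is exactly one solution with these initial values, and its value
at each site is a rational function of `x` and `y`. -/
def TwoDegreesOfFreedom {ι : Type} (S : Set (ι → ℂ)) (i j : ι) : Prop :=
  ∃ (E : ℕ → MvPolynomial (Fin 2) ℂ) (N D : ι → MvPolynomial (Fin 2) ℂ),
    (∀ l, E l ≠ 0) ∧
    ∀ x y : ℂ, Avoids E x y →
      (∀ s, MvPolynomial.eval ![x, y] (D s) ≠ 0) ∧
      ∀ f : ι → ℂ, (f ∈ S ∧ f i = x ∧ f j = y) ↔
        f = fun s => MvPolynomial.eval ![x, y] (N s) / MvPolynomial.eval ![x, y] (D s)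

end Q4Red

end

/-! Two independent mechanisms carry the theorem. The coincidence with (3) is local. Under (2), a
square with lower left corner $(n,n)$ or $(n-1,n)$ has two equal opposite corners. Its parameters
are $a=z+g$, $b=g-z$ with $z=z_j$ and $g=\gamma_e$ or $g=-\gamma_o$, so that $a-b=2z$. The addition
theorems for $\mathrm{sn}(z+g)+\mathrm{sn}(z-g)$, $\mathrm{sn}(z+g)\,\mathrm{sn}(z-g)$ and
$\mathrm{sn}(2z)$ turn $Q$, after multiplication by two nonzero factors, into $2k\,\mathrm{sn}(z)$
times the left side of (3); this is `Q_fold_iff`. The addition theorems come from the series: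
products of theta functions are bilinear in theta functions of doubled period (`jacobiTheta₂_mul`),
which reduces them to polynomial identities. The count of degrees of freedom is a well-founded
evolution: every site except two is determined by exactly one equation from earlier sites
(`Rule.twoDegreesOfFreedom`). What must be excluded is a denominator that vanishes identically. Two
properties survive each step (`Frac.Admissible`). At the origin every fraction is $0$ or $\infty$,
never $0/0$. Moreover inverting both initial data inverts every unknown, because the quad equation
is invariant under inversion of all its variables. If a denominator vanished identically, so would
the numerator, against the first property. A generic solution of (3) then lifts uniquely: the
lattice solution with the same two initial data restricts to a solution of (3), and uniqueness for
(3) identifies the two. -/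

noncomputable section

namespace Q4Red

open Complex

/-! ### Products of theta functions with the same period -/

/-- Splitting of `ℤ × ℤ` by the parity of `m - n`, where `(m, n) = (i + j, i - j)` or
`(m, n) = (i + j + 1, i - j)`. -/
def paritySplit : (ℤ × ℤ) ⊕ (ℤ × ℤ) ≃ ℤ × ℤ where
  toFun := Sum.elim (fun p => (p.1 + p.2, p.1 - p.2)) (fun p => (p.1 + p.2 + 1, p.1 - p.2))
  invFun q := if (q.1 + q.2) % 2 = 0 then Sum.inl ((q.1 + q.2) / 2, (q.1 - q.2) / 2)
    else Sum.inr ((q.1 + q.2 - 1) / 2, (q.1 - q.2 - 1) / 2)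
  left_inv := by
    rintro (⟨i, j⟩ | ⟨i, j⟩)
    · have h : (i + j + (i - j)) % 2 = 0 := by omega
      simp only [Sum.elim_inl, h, if_true]
      congr 2 <;> omega
    · have h : ¬ (i + j + 1 + (i - j)) % 2 = 0 := by omega
      simp only [Sum.elim_inr, h, if_false]
      congr 2 <;> omega
  right_inv := by
    rintro ⟨m, n⟩
    dsimp only
    split_ifs with h
    · simp only [Sum.elim_inl]
      congr 1 <;> omega
    · simp only [Sum.elim_inr]
      congr 1 <;> omega

/-- `θ₂` with the period `2t`. -/
def thetaB (t s : ℂ) : ℂ := exp (Real.pi * I * (t / 2 + s)) * jacobiTheta₂ (s + t) (2 * t)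

lemma summable_norm_term {t : ℂ} (ht : 0 < t.im) (z : ℂ) :
    Summable fun n : ℤ => ‖jacobiTheta₂_term n z t‖ :=
  ((summable_jacobiTheta₂_term_iff z t).2 ht).norm

lemma hasSum_mul_term {t : ℂ} (ht : 0 < t.im) (a b : ℂ) :
    HasSum (fun p : ℤ × ℤ => jacobiTheta₂_term p.1 a t * jacobiTheta₂_term p.2 b t)
      (jacobiTheta₂ a t * jacobiTheta₂ b t) := by
  have hs := summable_mul_of_summable_norm (summable_norm_term ht a) (summable_norm_term ht b)
  rw [jacobiTheta₂, jacobiTheta₂,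
    tsum_mul_tsum_of_summable_norm (summable_norm_term ht a) (summable_norm_term ht b)]
  exact hs.hasSum

/-- The product of two theta functions through theta functions of doubled period. -/
theorem jacobiTheta₂_mul {t : ℂ} (ht : 0 < t.im) (a b : ℂ) :
    jacobiTheta₂ a t * jacobiTheta₂ b t =
      jacobiTheta₂ (a + b) (2 * t) * jacobiTheta₂ (a - b) (2 * t) +
        thetaB t (a + b) * thetaB t (a - b) := by
  have h2 : 0 < (2 * t).im := by simpa using ht
  have h := (paritySplit.hasSum_iff).2 (hasSum_mul_term ht a b)
  refine h.unique (HasSum.sum ?_ ?_)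
  · convert hasSum_mul_term h2 (a + b) (a - b) using 2 with p
    simp only [Function.comp, paritySplit, Equiv.coe_fn_mk, Sum.elim_inl, jacobiTheta₂_term,
      ← exp_add]
    congr 1
    push_cast
    ring
  · have h3 := (hasSum_mul_term h2 (a + b + t) (a - b + t)).mul_left
      (exp (Real.pi * I * (t / 2 + (a + b))) * exp (Real.pi * I * (t / 2 + (a - b))))
    have e : thetaB t (a + b) * thetaB t (a - b) =
        exp (Real.pi * I * (t / 2 + (a + b))) * exp (Real.pi * I * (t / 2 + (a - b))) *
          (jacobiTheta₂ (a + b + t) (2 * t) * jacobiTheta₂ (a - b + t) (2 * t)) := by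
      unfold thetaB
      ring
    rw [e]
    refine h3.congr_fun fun p => ?_
    simp only [Function.comp, paritySplit, Equiv.coe_fn_mk, Sum.elim_inr, jacobiTheta₂_term,
      ← exp_add]
    congr 1
    push_cast
    ring

lemma exp_pi_I_mul_add_one (s : ℂ) : exp (Real.pi * I * (s + 1)) = -exp (Real.pi * I * s) := by
  rw [mul_add, exp_add, mul_one, exp_pi_mul_I, mul_neg_one]

lemma thetaB_add_one (t s : ℂ) : thetaB t (s + 1) = -thetaB t s := by
  unfold thetaB
  rw [← add_assoc, exp_pi_I_mul_add_one, add_right_comm s 1 t, jacobiTheta₂_add_left, neg_mul]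

/-- A shift by half of the period $2t$ exchanges the two functions on the right of
`jacobiTheta₂_mul`. This is how the half-period shifts inside $\theta_1,\theta_2$ are absorbed. -/
lemma exp_mul_thetaB_add (t s : ℂ) :
    exp (Real.pi * I * (t / 2 + s)) * thetaB t (s + t) = jacobiTheta₂ s (2 * t) := by
  unfold thetaB
  have h := jacobiTheta₂_add_left' s (2 * t)
  rw [show s + t + t = s + 2 * t by ring, h, ← mul_assoc, ← mul_assoc, ← exp_add, ← exp_add]
  rw [show Real.pi * I * (t / 2 + s) + Real.pi * I * (t / 2 + (s + t)) +
    -Real.pi * I * (2 * t + 2 * s) = 0 by ring, exp_zero, one_mul]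

/-- A theta function of doubled period at a quarter period. -/
def thetaP (t s : ℂ) : ℂ := exp (Real.pi * I * (s / 2 + t / 8)) * jacobiTheta₂ (s + t / 2) (2 * t)

/-- Quasi-periodicity and evenness reflect the argument, so the mixed products $\theta_2\theta_3$
and $\theta_1\theta_4$ need only the one function `thetaP`, taken at $\pm s$. -/
lemma exp_mul_thetaB_quarter (t s : ℂ) :
    exp (Real.pi * I * (s / 2 + t / 8)) * thetaB t (s + t / 2) = thetaP t (-s) := by
  unfold thetaB thetaP
  have h := jacobiTheta₂_add_left' (s - t / 2) (2 * t)
  rw [← jacobiTheta₂_neg_left (-s + t / 2), show -(-s + t / 2) = s - t / 2 by ring,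
    show s + t / 2 + t = s - t / 2 + 2 * t by ring, h, ← mul_assoc, ← mul_assoc, ← exp_add,
    ← exp_add]
  congr 2
  ring

lemma exp_mul_eq_thetaP_mul (t a b : ℂ) :
    exp (Real.pi * I * (t / 4 + a)) *
        (jacobiTheta₂ (a + b + t / 2) (2 * t) * jacobiTheta₂ (a - b + t / 2) (2 * t)) =
      thetaP t (a + b) * thetaP t (a - b) := by
  unfold thetaP
  rw [show Real.pi * I * (t / 4 + a) = Real.pi * I * ((a + b) / 2 + t / 8) +
    Real.pi * I * ((a - b) / 2 + t / 8) by ring, exp_add]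
  ring

lemma exp_mul_thetaB_mul (t a b : ℂ) :
    exp (Real.pi * I * (t / 4 + a)) * (thetaB t (a + b + t / 2) * thetaB t (a - b + t / 2)) =
      thetaP t (-(a + b)) * thetaP t (-(a - b)) := by
  rw [← exp_mul_thetaB_quarter, ← exp_mul_thetaB_quarter, show Real.pi * I * (t / 4 + a) =
    Real.pi * I * ((a + b) / 2 + t / 8) + Real.pi * I * ((a - b) / 2 + t / 8) by ring, exp_add]
  ring

section Products

variable (τ : UpperHalfPlane) (a b : ℂ)

local notation "ϑB" => thetaB (τ : ℂ)
local notation "ϑP" => thetaP (τ : ℂ)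

lemma theta3_mul_theta3 :
    theta3 τ a * theta3 τ b = jacobiTheta₂ (a + b) (2 * τ) * jacobiTheta₂ (a - b) (2 * τ) +
      ϑB (a + b) * ϑB (a - b) :=
  jacobiTheta₂_mul τ.im_pos a b

lemma theta4_mul_theta4 :
    theta4 τ a * theta4 τ b = jacobiTheta₂ (a + b) (2 * τ) * jacobiTheta₂ (a - b) (2 * τ) -
      ϑB (a + b) * ϑB (a - b) := by
  unfold theta4
  rw [jacobiTheta₂_mul τ.im_pos, show a + 1 / 2 + (b + 1 / 2) = a + b + 1 by ring,
    show a + 1 / 2 - (b + 1 / 2) = a - b by ring, jacobiTheta₂_add_left, thetaB_add_one]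
  ring

lemma theta2_mul_theta2 :
    theta2 τ a * theta2 τ b = ϑB (a + b) * jacobiTheta₂ (a - b) (2 * τ) +
      jacobiTheta₂ (a + b) (2 * τ) * ϑB (a - b) := by
  unfold theta2
  rw [mul_mul_mul_comm, jacobiTheta₂_mul τ.im_pos, ← exp_add,
    show a + (τ : ℂ) / 2 + (b + (τ : ℂ) / 2) = a + b + τ by ring,
    show a + (τ : ℂ) / 2 - (b + (τ : ℂ) / 2) = a - b by ring,
    show Real.pi * I * ((τ : ℂ) / 4 + a) + Real.pi * I * ((τ : ℂ) / 4 + b) =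
      Real.pi * I * ((τ : ℂ) / 2 + (a + b)) by ring, ← exp_mul_thetaB_add _ (a + b)]
  nth_rw 3 [thetaB]
  ring

lemma theta1_mul_theta1 :
    theta1 τ a * theta1 τ b = jacobiTheta₂ (a + b) (2 * τ) * ϑB (a - b) -
      ϑB (a + b) * jacobiTheta₂ (a - b) (2 * τ) := by
  unfold theta1
  rw [mul_mul_mul_comm, jacobiTheta₂_mul τ.im_pos,
    show a + 1 / 2 + (τ : ℂ) / 2 + (b + 1 / 2 + (τ : ℂ) / 2) = a + b + τ + 1 by ring,
    show a + 1 / 2 + (τ : ℂ) / 2 - (b + 1 / 2 + (τ : ℂ) / 2) = a - b by ring,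
    mul_mul_mul_comm, ← exp_add,
    show Real.pi * I * ((τ : ℂ) / 4 + a) + Real.pi * I * ((τ : ℂ) / 4 + b) =
      Real.pi * I * ((τ : ℂ) / 2 + (a + b)) by ring, ← exp_mul_thetaB_add _ (a + b),
    jacobiTheta₂_add_left, thetaB_add_one]
  have hB : ϑB (a + b) = exp (Real.pi * I * ((τ : ℂ) / 2 + (a + b))) *
    jacobiTheta₂ (a + b + τ) (2 * τ) := rfl
  linear_combination jacobiTheta₂ (a - b) (2 * τ) * hB + (exp (Real.pi * I * ((τ : ℂ) / 2 + (a + b))) *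
    (jacobiTheta₂ (a + b + τ) (2 * τ) * jacobiTheta₂ (a - b) (2 * τ) -
      ϑB (a + b + τ) * ϑB (a - b))) * I_sq

lemma theta2_mul_theta3 :
    theta2 τ a * theta3 τ b = ϑP (a + b) * ϑP (a - b) + ϑP (-(a + b)) * ϑP (-(a - b)) := by
  unfold theta2 theta3
  rw [mul_assoc, jacobiTheta₂_mul τ.im_pos, add_right_comm a, add_sub_right_comm a, mul_add,
    exp_mul_eq_thetaP_mul, exp_mul_thetaB_mul]

lemma theta1_mul_theta4 :
    theta1 τ a * theta4 τ b =
      -I * (ϑP (a + b) * ϑP (a - b) - ϑP (-(a + b)) * ϑP (-(a - b))) := by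
  unfold theta1 theta4
  rw [mul_assoc, mul_assoc, jacobiTheta₂_mul τ.im_pos,
    show a + 1 / 2 + (τ : ℂ) / 2 + (b + 1 / 2) = a + b + (τ : ℂ) / 2 + 1 by ring,
    show a + 1 / 2 + (τ : ℂ) / 2 - (b + 1 / 2) = a - b + (τ : ℂ) / 2 by ring,
    jacobiTheta₂_add_left, thetaB_add_one, ← exp_mul_eq_thetaP_mul, ← exp_mul_thetaB_mul]
  ring

end Products

/-! ### Parity -/

lemma theta3_neg (τ : UpperHalfPlane) (z : ℂ) : theta3 τ (-z) = theta3 τ z :=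
  jacobiTheta₂_neg_left z τ

lemma theta4_neg (τ : UpperHalfPlane) (z : ℂ) : theta4 τ (-z) = theta4 τ z := by
  unfold theta4
  rw [← jacobiTheta₂_neg_left (z + 1 / 2), ← jacobiTheta₂_add_left (-(z + 1 / 2))]
  congr 1
  ring

lemma theta2_neg (τ : UpperHalfPlane) (z : ℂ) : theta2 τ (-z) = theta2 τ z := by
  unfold theta2
  have h := jacobiTheta₂_add_left' (-z - (τ : ℂ) / 2) τ
  rw [show -z - (τ : ℂ) / 2 + τ = -z + (τ : ℂ) / 2 by ring,
    show -z - (τ : ℂ) / 2 = -(z + (τ : ℂ) / 2) by ring, jacobiTheta₂_neg_left] at h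
  rw [h, ← mul_assoc, ← exp_add]
  congr 2
  ring

/-- Up to sign $\theta_1$ is $\theta_2$ shifted by $1/2$; the evenness of $\theta_2$ and its sign
change under $z\mapsto z+1$ make $\theta_1$ odd. -/
lemma theta1_neg (τ : UpperHalfPlane) (z : ℂ) : theta1 τ (-z) = -theta1 τ z := by
  have h1 (w : ℂ) : theta1 τ w = -theta2 τ (w + 1 / 2) := by
    unfold theta1 theta2
    rw [show Real.pi * I * ((τ : ℂ) / 4 + (w + 1 / 2)) =
      Real.pi * I * ((τ : ℂ) / 4 + w) + Real.pi / 2 * I by ring, exp_add, exp_pi_div_two_mul_I]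
    ring
  have h2 (w : ℂ) : theta2 τ (w + 1) = -theta2 τ w := by
    unfold theta2
    rw [← add_assoc, exp_pi_I_mul_add_one, add_right_comm w, jacobiTheta₂_add_left, neg_mul]
  rw [h1, h1, show -z + 1 / 2 = -(z + 1 / 2) + 1 by ring, h2, theta2_neg]

/-! ### The theta constant `θ₄(0)` does not vanish -/

/-- Evenness and quasi-periodicity relate the value at this point to itself with multiplier $-1$. -/
lemma jacobiTheta₂_half_add_half_period (t : ℂ) : jacobiTheta₂ (1 / 2 + t) (2 * t) = 0 := by
  have h := jacobiTheta₂_add_left' (-(1 / 2 + t)) (2 * t)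
  rw [jacobiTheta₂_neg_left, show -(1 / 2 + t) + 2 * t = -(1 / 2) + t by ring,
    ← jacobiTheta₂_add_left, show -(1 / 2) + t + 1 = 1 / 2 + t by ring,
    show -Real.pi * I * (2 * t + 2 * -(1 / 2 + t)) = Real.pi * I by ring, exp_pi_mul_I] at h
  linear_combination h / 2

lemma jacobiTheta₂_half_two_mul_sq {t : ℂ} (ht : 0 < t.im) :
    jacobiTheta₂ (1 / 2) (2 * t) ^ 2 = jacobiTheta₂ 0 t * jacobiTheta₂ (1 / 2) t := by
  rw [jacobiTheta₂_mul ht, zero_add, zero_sub, jacobiTheta₂_neg_left, thetaB,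
    jacobiTheta₂_half_add_half_period]
  ring

/-- Termwise, since $n^2\equiv n$ mod $2$. It makes the bound on `jacobiTheta` near $i\infty$
available for $\theta_4(0)$. -/
lemma jacobiTheta₂_half (t : ℂ) : jacobiTheta₂ (1 / 2) t = jacobiTheta (1 + t) := by
  rw [jacobiTheta_eq_jacobiTheta₂]
  unfold jacobiTheta₂
  refine tsum_congr fun n => ?_
  unfold jacobiTheta₂_term
  rw [exp_eq_exp_iff_exists_int]
  obtain ⟨m, hm⟩ := Int.even_mul_pred_self n
  refine ⟨-m, ?_⟩
  have hm' : (n : ℂ) * (n - 1) = m + m := by exact_mod_cast hm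
  push_cast
  linear_combination (-Real.pi * I) * hm'

/-- By $\theta_4(0|2t)^2=\theta_3(0|t)\,\theta_4(0|t)$ a zero at $t$ propagates to every $2^nt$,
whereas $\theta_4(0)$ tends to $1$ as the imaginary part grows. -/
theorem jacobiTheta₂_half_ne_zero {t : ℂ} (ht : 0 < t.im) : jacobiTheta₂ (1 / 2) t ≠ 0 := by
  intro h0
  have hall (n : ℕ) : 0 < ((2 : ℂ) ^ n * t).im ∧ jacobiTheta₂ (1 / 2) (2 ^ n * t) = 0 := by
    induction n with
    | zero => simpa using ⟨ht, by simpa using h0⟩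
    | succ n ih =>
      have e : (2 : ℂ) ^ (n + 1) * t = 2 * (2 ^ n * t) := by ring
      rw [e]
      refine ⟨by simpa using ih.1, ?_⟩
      have h := jacobiTheta₂_half_two_mul_sq ih.1
      rw [ih.2, mul_zero] at h
      exact pow_eq_zero_iff two_ne_zero |>.1 h
  obtain ⟨n, hn⟩ := pow_unbounded_of_one_lt (1 / t.im) (one_lt_two (α := ℝ))
  obtain ⟨hpos, hz⟩ := hall n
  have him : ((2 : ℂ) ^ n * t).im = 2 ^ n * t.im := by
    rw [show (2 : ℂ) ^ n = ((2 ^ n : ℝ) : ℂ) by push_cast; rfl, im_ofReal_mul]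
  have him' : (1 + (2 : ℂ) ^ n * t).im = 2 ^ n * t.im := by simp [← him]
  have h1 : 1 < 2 ^ n * t.im := by rwa [div_lt_iff₀ ht] at hn
  have hb := norm_jacobiTheta_sub_one_le (τ := 1 + (2 : ℂ) ^ n * t) (by rw [him']; linarith)
  rw [← jacobiTheta₂_half, hz, him', zero_sub, norm_neg, norm_one] at hb
  set y := 2 ^ n * t.im
  -- With $e=\exp(-\pi y)$ the bound in `hb` reads $1\le 2e/(1-e)$, which forces $e\ge 1/3$.
  have he : Real.exp (-Real.pi * y) < 1 / 4 := by
    have h3 : 4 < Real.pi * y + 1 := by nlinarith [Real.pi_gt_three]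
    have h4 := Real.add_one_le_exp (Real.pi * y)
    rw [neg_mul, Real.exp_neg, inv_eq_one_div]
    exact one_div_lt_one_div_of_lt (by norm_num) (by linarith)
  rw [div_mul_eq_mul_div, le_div_iff₀ (by linarith)] at hb
  linarith

lemma theta4_zero_ne_zero (τ : UpperHalfPlane) : theta4 τ 0 ≠ 0 := by
  unfold theta4
  rw [zero_add]
  exact jacobiTheta₂_half_ne_zero τ.im_pos

/-! ### Addition theorems -/

section ThetaAddition

variable (τ : UpperHalfPlane) (x y : ℂ)

lemma theta_sq_relation : theta3 τ 0 ^ 2 * theta1 τ x ^ 2 + theta4 τ 0 ^ 2 * theta2 τ x ^ 2 =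
    theta2 τ 0 ^ 2 * theta4 τ x ^ 2 := by
  simp only [sq, theta3_mul_theta3, theta1_mul_theta1, theta4_mul_theta4, theta2_mul_theta2,
    sub_self, add_zero]
  ring

/-- Every product becomes bilinear in doubled-period functions at $2x$, $2y$ and $0$, and the claim
is then a polynomial identity. The other addition formulas of this section have the same proof. -/
lemma theta4_add_mul_theta4_sub : theta4 τ 0 ^ 2 * (theta4 τ (x + y) * theta4 τ (x - y)) =
    theta4 τ x ^ 2 * theta4 τ y ^ 2 - theta1 τ x ^ 2 * theta1 τ y ^ 2 := by
  simp only [sq, theta1_mul_theta1, theta4_mul_theta4, sub_self, add_zero,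
    show x + y + (x - y) = x + x by ring, show x + y - (x - y) = y + y by ring]
  ring

lemma theta1_add_mul_theta1_sub : theta4 τ 0 ^ 2 * (theta1 τ (x + y) * theta1 τ (x - y)) =
    theta1 τ x ^ 2 * theta4 τ y ^ 2 - theta4 τ x ^ 2 * theta1 τ y ^ 2 := by
  simp only [sq, theta1_mul_theta1, theta4_mul_theta4, sub_self, add_zero,
    show x + y + (x - y) = x + x by ring, show x + y - (x - y) = y + y by ring]
  ring

lemma theta1_add_mul_theta4_sub :
    theta2 τ 0 * theta3 τ 0 * (theta1 τ (x + y) * theta4 τ (x - y)) =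
      theta1 τ x * theta4 τ x * (theta2 τ y * theta3 τ y) +
        theta1 τ y * theta4 τ y * (theta2 τ x * theta3 τ x) := by
  simp only [theta1_mul_theta4, theta2_mul_theta3, sub_self, add_zero, neg_zero,
    show x + y + (x - y) = x + x by ring, show x + y - (x - y) = y + y by ring]
  ring

end ThetaAddition

/-! ### Addition theorems for the Jacobi elliptic functions. -/

section Elliptic

variable (τ : UpperHalfPlane)

lemma arg_neg (u : ℂ) : arg τ (-u) = -arg τ u := neg_div _ _

lemma arg_add (u v : ℂ) : arg τ (u + v) = arg τ u + arg τ v := add_div _ _ _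

lemma arg_sub (u v : ℂ) : arg τ (u - v) = arg τ u - arg τ v := sub_div _ _ _

lemma sn_neg (u : ℂ) : sn τ (-u) = -sn τ u := by
  unfold sn
  rw [arg_neg, theta1_neg, theta4_neg]
  ring

lemma cn_neg (u : ℂ) : cn τ (-u) = cn τ u := by
  unfold cn
  rw [arg_neg, theta2_neg, theta4_neg]

lemma dn_neg (u : ℂ) : dn τ (-u) = dn τ u := by
  unfold dn
  rw [arg_neg, theta3_neg, theta4_neg]

lemma isPole_neg (u : ℂ) : IsPole τ (-u) ↔ IsPole τ u := by
  unfold IsPole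
  rw [arg_neg, theta4_neg]

/-- With division by zero equal to zero, the prefactor $\theta_3(0)/\theta_2(0)$ of `sn` vanishes as
soon as either theta constant does. -/
lemma theta_zero_ne_zero_of_sn_ne_zero {u : ℂ} (h : sn τ u ≠ 0) :
    theta2 τ 0 ≠ 0 ∧ theta3 τ 0 ≠ 0 := by
  constructor <;> rintro h0 <;> simp [sn, h0] at h

lemma modulus_ne_zero_of_sn_ne_zero {u : ℂ} (h : sn τ u ≠ 0) : modulus τ ≠ 0 := by
  obtain ⟨h2, h3⟩ := theta_zero_ne_zero_of_sn_ne_zero τ h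
  unfold modulus
  positivity

variable {τ}

lemma cn_sq (h2 : theta2 τ 0 ≠ 0) {u : ℂ} (hu : ¬ IsPole τ u) : cn τ u ^ 2 = 1 - sn τ u ^ 2 := by
  have h := theta_sq_relation τ (arg τ u)
  unfold IsPole at hu
  unfold cn sn
  field_simp
  linear_combination h

/-- The denominator of the addition theorems as a theta quotient: it shows that this denominator
vanishes only if $u+v$ or $u-v$ is a pole. -/
lemma one_sub_modulus_sq_mul (h2 : theta2 τ 0 ≠ 0) (h3 : theta3 τ 0 ≠ 0) {u v : ℂ}
    (hu : ¬ IsPole τ u) (hv : ¬ IsPole τ v) :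
    1 - modulus τ ^ 2 * sn τ u ^ 2 * sn τ v ^ 2 = theta4 τ 0 ^ 2 *
      (theta4 τ (arg τ (u + v)) * theta4 τ (arg τ (u - v))) /
        (theta4 τ (arg τ u) ^ 2 * theta4 τ (arg τ v) ^ 2) := by
  rw [arg_add, arg_sub, theta4_add_mul_theta4_sub]
  unfold IsPole at hu hv
  unfold modulus sn
  field_simp

lemma one_sub_modulus_sq_mul_ne_zero (h2 : theta2 τ 0 ≠ 0) (h3 : theta3 τ 0 ≠ 0)
    {u v : ℂ} (hu : ¬ IsPole τ u) (hv : ¬ IsPole τ v)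
    (ha : ¬ IsPole τ (u + v)) (hs : ¬ IsPole τ (u - v)) :
    1 - modulus τ ^ 2 * sn τ u ^ 2 * sn τ v ^ 2 ≠ 0 := by
  rw [one_sub_modulus_sq_mul h2 h3 hu hv]
  have h4 := theta4_zero_ne_zero τ
  unfold IsPole at *
  positivity

/-- The addition theorem of `sn`. -/
theorem sn_add (h2 : theta2 τ 0 ≠ 0) (h3 : theta3 τ 0 ≠ 0) {u v : ℂ}
    (hu : ¬ IsPole τ u) (hv : ¬ IsPole τ v) (ha : ¬ IsPole τ (u + v)) :
    sn τ (u + v) * (1 - modulus τ ^ 2 * sn τ u ^ 2 * sn τ v ^ 2) =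
      sn τ u * (cn τ v * dn τ v) + sn τ v * (cn τ u * dn τ u) := by
  have h := theta1_add_mul_theta4_sub τ (arg τ u) (arg τ v)
  rw [one_sub_modulus_sq_mul h2 h3 hu hv]
  unfold IsPole at *
  unfold sn cn dn
  rw [arg_add] at *
  rw [arg_sub]
  field_simp
  linear_combination theta4 τ 0 ^ 2 * h

theorem sn_add_mul_sn_sub (h2 : theta2 τ 0 ≠ 0) (h3 : theta3 τ 0 ≠ 0) {u v : ℂ}
    (hu : ¬ IsPole τ u) (hv : ¬ IsPole τ v)
    (ha : ¬ IsPole τ (u + v)) (hs : ¬ IsPole τ (u - v)) :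
    sn τ (u + v) * sn τ (u - v) * (1 - modulus τ ^ 2 * sn τ u ^ 2 * sn τ v ^ 2) =
      sn τ u ^ 2 - sn τ v ^ 2 := by
  have h := theta1_add_mul_theta1_sub τ (arg τ u) (arg τ v)
  rw [one_sub_modulus_sq_mul h2 h3 hu hv]
  unfold IsPole at *
  unfold sn
  rw [arg_add, arg_sub] at *
  field_simp
  linear_combination h

end Elliptic

/-! ### Squares on the diagonal -/

/-- The left-hand side of the second-order equation in the variables `w = u_{n-1}`, `x = u_n`,
`y = u_{n+1}`. -/
def rcgPoly (τ : UpperHalfPlane) (g z w x y : ℂ) : ℂ :=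
  cn τ g * dn τ g * (1 - modulus τ ^ 2 * sn τ z ^ 4) * x * (y + w)
    - cn τ z * dn τ z * (1 - modulus τ ^ 2 * sn τ z ^ 2 * sn τ g ^ 2) * (y * w + x ^ 2)
    + (cn τ z ^ 2 - cn τ g ^ 2) * cn τ z * dn τ z * (1 + modulus τ ^ 2 * x ^ 2 * y * w)

lemma rcgPoly_neg (τ : UpperHalfPlane) (g z w x y : ℂ) :
    rcgPoly τ (-g) z w x y = rcgPoly τ g z w x y := by
  simp only [rcgPoly, cn_neg, dn_neg, sn_neg, neg_sq]

/-- On a square that is folded along its diagonal, the lattice equation with the parameters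
`z + g`, `g - z` is the second-order equation. -/
theorem Q_fold_iff {τ : UpperHalfPlane} {r g z : ℂ} (hr : r ^ 2 = modulus τ)
    (hg : ¬ IsPole τ g) (hz : ¬ IsPole τ z) (ha : ¬ IsPole τ (z + g)) (hs : ¬ IsPole τ (z - g))
    (h2z : ¬ IsPole τ (z + z)) (hsn : sn τ z ≠ 0) (w x y : ℂ) :
    Q τ (z + g) (g - z) (r * w) (r * x) (r * x) (r * y) = 0 ↔ rcgPoly τ g z w x y = 0 := by
  obtain ⟨h2, h3⟩ := theta_zero_ne_zero_of_sn_ne_zero τ hsn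
  have hk := modulus_ne_zero_of_sn_ne_zero τ hsn
  have hL := one_sub_modulus_sq_mul_ne_zero h2 h3 hz hg ha hs
  have hs' : ¬ IsPole τ (z + -g) := by rwa [← sub_eq_add_neg]
  have hM := sn_add h2 h3 hz hz h2z
  -- Case $u=v=z$: the difference is $0$, which is not a pole because $\theta_4(0)\ne0$.
  have hM0 : 1 - modulus τ ^ 2 * sn τ z ^ 2 * sn τ z ^ 2 ≠ 0 :=
    one_sub_modulus_sq_mul_ne_zero h2 h3 hz hz h2z (by
      rw [sub_self]
      unfold IsPole
      rw [arg, zero_div]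
      exact theta4_zero_ne_zero τ)
  have e1 := sn_add h2 h3 hz hg ha
  have e2 := sn_add h2 h3 hz (v := -g) (by rwa [isPole_neg]) hs'
  rw [sn_neg, cn_neg, dn_neg, neg_sq, ← sub_eq_add_neg] at e2
  have e3 := sn_add_mul_sn_sub h2 h3 hz hg ha hs
  have c1 := cn_sq h2 hz
  have c2 := cn_sq h2 hg
  -- The factors are the denominators of $\mathrm{sn}(2z)$ and $\mathrm{sn}(z\pm g)$. In `e1 + e2`
  -- the terms with $\mathrm{sn}(g)$ cancel, and $r^2=k$ lets one factor $k$ be taken out.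
  have key : Q τ (z + g) (g - z) (r * w) (r * x) (r * x) (r * y) *
      ((1 - modulus τ ^ 2 * sn τ z ^ 2 * sn τ z ^ 2) *
        (1 - modulus τ ^ 2 * sn τ z ^ 2 * sn τ g ^ 2)) =
      2 * sn τ z * modulus τ * rcgPoly τ g z w x y := by
    unfold Q rcgPoly
    rw [show z + g - (g - z) = z + z by ring, show g - z = -(z - g) by ring, sn_neg, c1, c2, ← hr]
    rw [← hr] at hM e1 e2 e3
    generalize sn τ (z + g) = p at *
    generalize sn τ (z - g) = q at *
    generalize sn τ (z + z) = d at *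
    linear_combination (1 - (r ^ 2) ^ 2 * sn τ z ^ 2 * sn τ z ^ 2) * r ^ 2 * x * (w + y) * (e1 + e2)
      - r ^ 2 * (1 - (r ^ 2) ^ 2 * sn τ z ^ 2 * sn τ g ^ 2) *
        (x ^ 2 + w * y + p * q * (1 + r ^ 4 * x ^ 2 * w * y)) * hM
      - 2 * sn τ z * (cn τ z * dn τ z) * r ^ 2 * (1 + r ^ 4 * x ^ 2 * w * y) * e3
  have hc : 2 * sn τ z * modulus τ ≠ 0 := mul_ne_zero (mul_ne_zero two_ne_zero hsn) hk
  rw [← mul_eq_zero_iff_right (mul_ne_zero hM0 hL), key, mul_eq_zero_iff_left hc]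

/-! ### Multi-affine quad equations and their evolution -/

/-- The coefficients of a multi-affine quad equation of the symmetric eight-term form. -/
structure QuadCoeff where
  /-- the coefficient of `wx + yz` -/
  A : ℂ
  /-- the coefficient of `wy + xz` -/
  B : ℂ
  /-- the coefficient of `xy + wz` -/
  C : ℂ
  /-- the coefficient of `1 + wxyz` -/
  D : ℂ

namespace QuadCoeff

/-- The quad polynomial. -/
def poly (c : QuadCoeff) (w x y z : ℂ) : ℂ :=
  c.A * (w * x + y * z) + c.B * (w * y + x * z) + c.C * (x * y + w * z) + c.D * (1 + w * x * y * z)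

/-- All coefficients are nonzero. -/
def Nondegenerate (c : QuadCoeff) : Prop := c.A ≠ 0 ∧ c.B ≠ 0 ∧ c.C ≠ 0 ∧ c.D ≠ 0

/-- The coefficients after the exchange of the third and the fourth variable. -/
def swapLast (c : QuadCoeff) : QuadCoeff := ⟨c.A, c.C, c.B, c.D⟩

/-- The coefficients after the cyclic shift of the last three variables. -/
def rotate (c : QuadCoeff) : QuadCoeff := ⟨c.B, c.C, c.A, c.D⟩

lemma Nondegenerate.swapLast {c : QuadCoeff} (h : c.Nondegenerate) : c.swapLast.Nondegenerate :=
  ⟨h.1, h.2.2.1, h.2.1, h.2.2.2⟩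

lemma Nondegenerate.rotate {c : QuadCoeff} (h : c.Nondegenerate) : c.rotate.Nondegenerate :=
  ⟨h.2.1, h.2.2.1, h.1, h.2.2.2⟩

/-- These symmetries move the unknown corner into the last slot, so that the single function
`QuadCoeff.solve` serves all four directions of evolution. -/
lemma poly_swapLast (c : QuadCoeff) (w x y z : ℂ) : c.swapLast.poly w x y z = c.poly w x z y := by
  simp only [poly, swapLast]
  ring

lemma poly_rotate (c : QuadCoeff) (w x y z : ℂ) : c.rotate.poly w x y z = c.poly w z x y := by
  simp only [poly, rotate]
  ring

lemma poly_reverse (c : QuadCoeff) (w x y z : ℂ) : c.poly z y x w = c.poly w x y z := by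
  simp only [poly]
  ring

end QuadCoeff

/-- Numerator and denominator of a rational function of the initial data. -/
abbrev Frac : Type := MvPolynomial (Fin 2) ℂ × MvPolynomial (Fin 2) ℂ

/-- The fourth variable of a quad equation through the other three. -/
def QuadCoeff.solve (c : QuadCoeff) (w x y : Frac) : Frac :=
  (-(.C c.A * (w.1 * x.1 * y.2) + .C c.B * (w.1 * y.1 * x.2) + .C c.C * (x.1 * y.1 * w.2)
      + .C c.D * (w.2 * x.2 * y.2)),
    .C c.A * (y.1 * w.2 * x.2) + .C c.B * (x.1 * w.2 * y.2) + .C c.C * (w.1 * x.2 * y.2)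
      + .C c.D * (w.1 * x.1 * y.1))

/-- The value of a fraction at a point. -/
def Frac.value (x y : ℂ) (p : Frac) : ℂ :=
  MvPolynomial.eval ![x, y] p.1 / MvPolynomial.eval ![x, y] p.2

lemma QuadCoeff.poly_eq_zero_iff (c : QuadCoeff) {x y : ℂ} {p q s : Frac}
    (hp : MvPolynomial.eval ![x, y] p.2 ≠ 0) (hq : MvPolynomial.eval ![x, y] q.2 ≠ 0)
    (hs : MvPolynomial.eval ![x, y] s.2 ≠ 0)
    (hd : MvPolynomial.eval ![x, y] (c.solve p q s).2 ≠ 0) (z : ℂ) :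
    c.poly (p.value x y) (q.value x y) (s.value x y) z = 0 ↔ z = (c.solve p q s).value x y := by
  have key : c.poly (p.value x y) (q.value x y) (s.value x y) z *
      (MvPolynomial.eval ![x, y] p.2 * MvPolynomial.eval ![x, y] q.2 *
        MvPolynomial.eval ![x, y] s.2) =
      z * MvPolynomial.eval ![x, y] (c.solve p q s).2 -
        MvPolynomial.eval ![x, y] (c.solve p q s).1 := by
    simp only [QuadCoeff.solve, QuadCoeff.poly, Frac.value, map_add, map_mul, map_neg,
      MvPolynomial.eval_C]
    field_simp
    ring
  rw [← mul_eq_zero_iff_right (mul_ne_zero (mul_ne_zero hp hq) hs), key, sub_eq_zero,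
    Frac.value, eq_div_iff hd]

/-- At the origin the fraction is zero or infinite, and the inversion of the initial data inverts
the fraction. -/
def Frac.Admissible (p : Frac) : Prop :=
  ((MvPolynomial.eval ![0, 0] p.1 = 0 ∧ MvPolynomial.eval ![0, 0] p.2 ≠ 0) ∨
    (MvPolynomial.eval ![0, 0] p.1 ≠ 0 ∧ MvPolynomial.eval ![0, 0] p.2 = 0)) ∧
  ∀ a b : ℂ, a ≠ 0 → b ≠ 0 → ∃ c : ℂ,
    MvPolynomial.eval ![a⁻¹, b⁻¹] p.1 = c * MvPolynomial.eval ![a, b] p.2 ∧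
    MvPolynomial.eval ![a⁻¹, b⁻¹] p.2 = c * MvPolynomial.eval ![a, b] p.1

lemma eq_zero_of_eval_eq_zero {p : MvPolynomial (Fin 2) ℂ}
    (h : ∀ a b : ℂ, a ≠ 0 → b ≠ 0 → MvPolynomial.eval ![a, b] p = 0) : p = 0 := by
  -- The factor kills the coordinate axes, where nothing is known about `p`.
  have h0 : p * (MvPolynomial.X 0 * MvPolynomial.X 1) = 0 := by
    refine MvPolynomial.funext fun f => ?_
    rw [show f = ![f 0, f 1] by ext i; fin_cases i <;> rfl]
    by_cases h1 : f 0 = 0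
    · simp [h1]
    by_cases h2 : f 1 = 0
    · simp [h2]
    simp [h _ _ h1 h2]
  exact (mul_eq_zero.1 h0).resolve_right
    (mul_ne_zero (MvPolynomial.X_ne_zero 0) (MvPolynomial.X_ne_zero 1))

/-- By the inversion symmetry a vanishing denominator entails a vanishing numerator, which the value
at the origin forbids. -/
lemma Frac.Admissible.den_ne_zero {p : Frac} (hp : p.Admissible) : p.2 ≠ 0 := by
  intro h0
  have h1 : p.1 = 0 := eq_zero_of_eval_eq_zero fun a b ha hb => by
    obtain ⟨c, hc, -⟩ := hp.2 a⁻¹ b⁻¹ (inv_ne_zero ha) (inv_ne_zero hb)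
    rwa [inv_inv, inv_inv, h0, map_zero, mul_zero] at hc
  have h := hp.1
  simp [h0, h1] at h

lemma Frac.Admissible.X (k : Fin 2) : Frac.Admissible (MvPolynomial.X k, 1) := by
  refine ⟨Or.inl ⟨?_, by simp⟩, fun a b ha hb => ⟨(![a, b] k)⁻¹, ?_⟩⟩
  · fin_cases k <;> simp
  · fin_cases k <;> simp [ha, hb]

/-- At the origin exactly one of the eight terms survives: in the numerator if an even number of the
three inputs is infinite, in the denominator otherwise. As all four coefficients are nonzero, the
output is again $\infty$ or $0$. Inversion of the inputs swaps numerator and denominator up to a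
common factor. -/
lemma QuadCoeff.Nondegenerate.admissible_solve {c : QuadCoeff} (hc : c.Nondegenerate)
    {p q s : Frac} (hp : p.Admissible) (hq : q.Admissible) (hs : s.Admissible) :
    (c.solve p q s).Admissible := by
  obtain ⟨hA, hB, hC, hD⟩ := hc
  refine ⟨?_, fun a b ha hb => ?_⟩
  · rcases hp.1 with ⟨h1, h2⟩ | ⟨h1, h2⟩ <;> rcases hq.1 with ⟨h3, h4⟩ | ⟨h3, h4⟩ <;>
      rcases hs.1 with ⟨h5, h6⟩ | ⟨h5, h6⟩ <;>
      simp [QuadCoeff.solve, h1, h2, h3, h4, h5, h6, hA, hB, hC, hD]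
  · obtain ⟨l, hl, hl'⟩ := hp.2 a b ha hb
    obtain ⟨m, hm, hm'⟩ := hq.2 a b ha hb
    obtain ⟨n, hn, hn'⟩ := hs.2 a b ha hb
    refine ⟨-(l * m * n), ?_, ?_⟩ <;>
    · simp only [QuadCoeff.solve, map_add, map_mul, map_neg, MvPolynomial.eval_C, hl, hl', hm, hm',
        hn, hn']
      ring

/-! ### Evolution schemes -/

/-- How the unknown at a site is determined: it is one of the two initial data, or equal to
another unknown, or the solution of a quad equation whose other unknowns are given. -/
inductive Rule (ι : Type)
  | datum (k : Fin 2)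
  | copy (s : ι)
  | solve (c : QuadCoeff) (s₁ s₂ s₃ : ι)

namespace Rule

variable {ι : Type}

/-- The equation that the rule imposes on the unknown `z`. -/
def Holds (f : ι → ℂ) (z : ℂ) : Rule ι → Prop
  | datum _ => True
  | copy s => z = f s
  | solve c s₁ s₂ s₃ => c.poly (f s₁) (f s₂) (f s₃) z = 0

/-- The fraction that the rule determines. -/
def frac (V : ι → Frac) : Rule ι → Frac
  | datum k => (MvPolynomial.X k, 1)
  | copy s => V s
  | solve c s₁ s₂ s₃ => c.solve (V s₁) (V s₂) (V s₃)

/-- All sites used by the rule satisfy `p`, and the quad equation is nondegenerate. -/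
def Uses (p : ι → Prop) : Rule ι → Prop
  | datum _ => True
  | copy s => p s
  | solve c s₁ s₂ s₃ => c.Nondegenerate ∧ p s₁ ∧ p s₂ ∧ p s₃

lemma Uses.mono {p q : ι → Prop} (h : ∀ s, p s → q s) {R : Rule ι} (hR : R.Uses p) :
    R.Uses q := by
  cases R with
  | datum => trivial
  | copy s => exact h s hR
  | solve c s₁ s₂ s₃ => exact ⟨hR.1, h _ hR.2.1, h _ hR.2.2.1, h _ hR.2.2.2⟩

lemma frac_congr {V W : ι → Frac} {R : Rule ι} (h : R.Uses fun s => V s = W s) :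
    R.frac V = R.frac W := by
  cases R with
  | datum => rfl
  | copy s => exact h
  | solve c s₁ s₂ s₃ =>
    obtain ⟨-, h1, h2, h3⟩ := h
    simp only [frac, h1, h2, h3]

lemma admissible_frac {V : ι → Frac} {R : Rule ι} (h : R.Uses fun s => (V s).Admissible) :
    (R.frac V).Admissible := by
  cases R with
  | datum k => exact Frac.Admissible.X k
  | copy s => exact h
  | solve c s₁ s₂ s₃ => exact h.1.admissible_solve h.2.1 h.2.2.1 h.2.2.2

lemma exists_frac {α : Type*} [Preorder α] [WellFoundedLT α] (rank : ι → α) (R : ι → Rule ι)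
    (hR : ∀ s, (R s).Uses fun t => rank t < rank s) : ∃ V : ι → Frac, ∀ s, V s = (R s).frac V := by
  classical
  have wf : WellFounded fun s t : ι => rank s < rank t :=
    InvImage.wf rank (wellFounded_lt (α := α))
  -- The default `(0, 1)` is never used, because a rule refers only to sites of smaller rank.
  let F : ∀ s, (∀ t, rank t < rank s → Frac) → Frac := fun s ih =>
    (R s).frac fun t => if h : rank t < rank s then ih t h else (0, 1)
  refine ⟨wf.fix F, fun s => ?_⟩
  rw [wf.fix_eq]
  refine frac_congr ((hR s).mono fun t ht => ?_)
  rw [dif_pos ht]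

/-- A well-founded evolution scheme has two degrees of freedom. -/
theorem twoDegreesOfFreedom [Countable ι] {α : Type*} [Preorder α] [WellFoundedLT α]
    (rank : ι → α) (R : ι → Rule ι) (hR : ∀ s, (R s).Uses fun t => rank t < rank s) {i j : ι}
    (hi : ∀ s, R s = datum 0 ↔ s = i) (hj : ∀ s, R s = datum 1 ↔ s = j) :
    TwoDegreesOfFreedom {f : ι → ℂ | ∀ s, (R s).Holds f (f s)} i j := by
  classical
  obtain ⟨V, hV⟩ := exists_frac rank R hR
  have wf : WellFounded fun s t : ι => rank s < rank t :=
    InvImage.wf rank (wellFounded_lt (α := α))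
  have hadm (s : ι) : (V s).Admissible := by
    induction s using wf.induction with
    | _ s ih =>
      rw [hV s]
      exact admissible_frac ((hR s).mono ih)
  obtain ⟨e, he⟩ := exists_injective_nat ι
  have : Nonempty ι := ⟨i⟩
  -- The exceptional curves are the zero sets of the denominators, enumerated through `e`. Indices
  -- outside the range of `e` merely repeat some denominator.
  refine ⟨fun l => (V (Function.invFun e l)).2, fun s => (V s).1, fun s => (V s).2,
    fun l => (hadm _).den_ne_zero, fun x y hxy => ?_⟩
  have hD (s : ι) : MvPolynomial.eval ![x, y] (V s).2 ≠ 0 := by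
    have h := hxy (e s)
    dsimp only at h
    rwa [Function.leftInverse_invFun he s] at h
  refine ⟨hD, fun f => ⟨?_, ?_⟩⟩
  · rintro ⟨hf, hx, hy⟩
    funext s
    induction s using wf.induction with
    | _ s ih =>
      change f s = (V s).value x y
      have h1 := hf s
      have h2 := (hR s).mono ih
      have h3 := hV s
      have h4 := hD s
      rw [h3] at h4 ⊢
      have hi' := hi s
      have hj' := hj s
      cases hs : R s with
      | datum k =>
        rw [hs] at hi' hj'
        fin_cases k
        · simp [hi'.1 rfl, hx, frac, Frac.value]
        · simp [hj'.1 rfl, hy, frac, Frac.value]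
      | copy t =>
        rw [hs] at h1 h2
        exact h1.trans h2
      | solve c s₁ s₂ s₃ =>
        rw [hs] at h1 h2 h4
        obtain ⟨-, e1, e2, e3⟩ := h2
        simp only [Holds] at h1
        rw [e1, e2, e3] at h1
        exact (c.poly_eq_zero_iff (hD s₁) (hD s₂) (hD s₃) h4 _).1 h1
  · rintro rfl
    refine ⟨fun s => ?_, ?_, ?_⟩
    · change (R s).Holds (fun t => (V t).value x y) ((V s).value x y)
      have h3 := hV s
      have h4 := hD s
      rw [h3] at h4 ⊢
      cases hs : R s with
      | datum k => trivial
      | copy t => rfl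
      | solve c s₁ s₂ s₃ =>
        rw [hs] at h4
        exact (c.poly_eq_zero_iff (hD s₁) (hD s₂) (hD s₃) h4 _).2 rfl
    · dsimp only
      rw [hV i, (hi i).2 rfl]
      simp [frac]
    · dsimp only
      rw [hV j, (hj j).2 rfl]
      simp [frac]

end Rule

/-- Serves to pass from $v$ to $u=v/\sqrt k$; the initial data are rescaled by the substitution `σ`
in the polynomials. -/
lemma TwoDegreesOfFreedom.rescale {ι : Type} {S : Set (ι → ℂ)} {i j : ι} {ρ : ℂ} (hρ : ρ ≠ 0)
    (h : TwoDegreesOfFreedom S i j) :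
    TwoDegreesOfFreedom {u : ι → ℂ | (fun s => ρ * u s) ∈ S} i j := by
  obtain ⟨E, N, D, hE, h⟩ := h
  let σ : MvPolynomial (Fin 2) ℂ →ₐ[ℂ] MvPolynomial (Fin 2) ℂ :=
    MvPolynomial.aeval fun k => MvPolynomial.C ρ * MvPolynomial.X k
  have hσ (p : MvPolynomial (Fin 2) ℂ) (x y : ℂ) :
      MvPolynomial.eval ![x, y] (σ p) = MvPolynomial.eval ![ρ * x, ρ * y] p := by
    have : (MvPolynomial.aeval (R := ℂ) ![x, y]).comp σ = MvPolynomial.aeval ![ρ * x, ρ * y] := by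
      ext k
      fin_cases k <;> simp [σ]
    exact DFunLike.congr_fun this p
  refine ⟨fun l => σ (E l), fun s => σ (N s), fun s => MvPolynomial.C ρ * σ (D s), fun l h0 => ?_,
    fun x y hxy => ?_⟩
  · refine hE l (MvPolynomial.funext fun f => ?_)
    dsimp only at h0
    have h1 := hσ (E l) (ρ⁻¹ * f 0) (ρ⁻¹ * f 1)
    rw [h0, map_zero, mul_inv_cancel_left₀ hρ, mul_inv_cancel_left₀ hρ] at h1
    rw [map_zero, h1]
    congr 2
    ext i
    fin_cases i <;> rfl
  · obtain ⟨hD, hf⟩ := h (ρ * x) (ρ * y) fun l => by rw [← hσ]; exact hxy l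
    refine ⟨fun s => ?_, fun f => ?_⟩
    · rw [map_mul, MvPolynomial.eval_C, hσ]
      exact mul_ne_zero hρ (hD s)
    · have h1 := hf fun s => ρ * f s
      rw [mul_right_inj' hρ, mul_right_inj' hρ] at h1
      refine h1.trans ?_
      simp only [funext_iff, map_mul, MvPolynomial.eval_C, hσ]
      refine forall_congr' fun s => ?_
      have := hD s
      rw [eq_div_iff this, eq_div_iff (mul_ne_zero hρ this)]
      constructor <;> intro h2 <;> linear_combination h2

/-! ### The evolution on the lattice -/

/-- The evolution from the diagonal path to the lattice. -/
def latticeRule (c : ℤ → ℤ → QuadCoeff) : ℤ × ℤ → Rule (ℤ × ℤ) := fun (n, m) =>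
  if 3 ≤ m - n then .solve (c n (m - 1)).swapLast (n, m - 1) (n + 1, m - 1) (n + 1, m)
  else if m - n ≤ -2 then .solve (c (n - 1) m).rotate (n - 1, m) (n - 1, m + 1) (n, m + 1)
  else if m - n = 2 then .copy (n + 1, m - 1)
  else if m - n = -1 then .copy (m, n)
  else if n + m = 0 then .datum 0
  else if n + m = 1 then .datum 1
  else if 1 < n + m then .solve (c (n - 1) (m - 1)) (n - 1, m - 1) (n, m - 1) (n - 1, m)
  else .solve (c n m) (n + 1, m + 1) (n, m + 1) (n + 1, m)

/-- The order in which the sites of the lattice are reached. -/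
def latticeRank : ℤ × ℤ → ℕ ×ₗ ℕ := fun (n, m) =>
  toLex ((2 * (m - n) - 1).natAbs - 3,
    2 * (2 * (n + m) - 1).natAbs + ((2 * (m - n) - 1).natAbs - 1) / 2)

lemma latticeRank_lt {n m n' m' : ℤ}
    (h : (2 * (m - n) - 1).natAbs - 3 < (2 * (m' - n') - 1).natAbs - 3 ∨
      (2 * (m - n) - 1).natAbs - 3 = (2 * (m' - n') - 1).natAbs - 3 ∧
        2 * (2 * (n + m) - 1).natAbs + ((2 * (m - n) - 1).natAbs - 1) / 2 <
          2 * (2 * (n' + m') - 1).natAbs + ((2 * (m' - n') - 1).natAbs - 1) / 2) :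
    latticeRank (n, m) < latticeRank (n', m') :=
  Prod.Lex.toLex_lt_toLex.2 h

/-- The truncated subtraction makes the first component of the rank vanish on the strip $-1\le
m-n\le2$, and outside it grows with the distance from the strip. Within the strip the second
component measures the distance from $n+m=1/2$, and its last summand puts the copied diagonals
$m-n=-1,2$ after the path $m-n=0,1$. -/
lemma latticeRule_uses {c : ℤ → ℤ → QuadCoeff} (hc : ∀ n m, (c n m).Nondegenerate) (s : ℤ × ℤ) :
    (latticeRule c s).Uses fun t => latticeRank t < latticeRank s := by
  obtain ⟨n, m⟩ := s
  unfold latticeRule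
  dsimp only
  split_ifs with h1 h2 h3 h4 h5 h6 h7
  · refine ⟨(hc _ _).swapLast, ?_, ?_, ?_⟩ <;> exact latticeRank_lt (by omega)
  · refine ⟨(hc _ _).rotate, ?_, ?_, ?_⟩ <;> exact latticeRank_lt (by omega)
  · exact latticeRank_lt (by omega)
  · exact latticeRank_lt (by omega)
  · trivial
  · trivial
  · refine ⟨hc _ _, ?_, ?_, ?_⟩ <;> exact latticeRank_lt (by omega)
  · refine ⟨hc _ _, ?_, ?_, ?_⟩ <;> exact latticeRank_lt (by omega)

/-- Each square and each constraint is the rule of exactly one site. A square determines its upper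
left corner if $m-n\ge2$ and its lower right corner if $m-n\le-1$. The squares between determine the
upper right corner if $n+m\ge0$ and the lower left one otherwise. -/
lemma latticeRule_holds_iff (c : ℤ → ℤ → QuadCoeff) (v : ℤ × ℤ → ℂ) :
    (∀ s, (latticeRule c s).Holds v (v s)) ↔
      (∀ n m, (c n m).poly (v (n, m)) (v (n + 1, m)) (v (n, m + 1)) (v (n + 1, m + 1)) = 0) ∧
        Ridge v := by
  constructor
  · intro h
    have hridge : Ridge v := by
      intro n
      have h1 := h (n + 1, n)
      have h2 := h (n - 1, n + 1)
      simp only [latticeRule] at h1 h2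
      rw [if_neg (by omega), if_neg (by omega), if_neg (by omega), if_pos (by omega)] at h1
      rw [if_neg (by omega), if_neg (by omega), if_pos (by omega)] at h2
      simp only [Rule.Holds, sub_add_cancel, add_sub_cancel_right] at h1 h2
      exact ⟨h1.symm, h2.symm⟩
    refine ⟨fun n m => ?_, hridge⟩
    rcases le_or_gt 2 (m - n) with h1 | h1
    · have h2 := h (n, m + 1)
      simp only [latticeRule] at h2
      rw [if_pos (by omega)] at h2
      simpa only [Rule.Holds, QuadCoeff.poly_swapLast, add_sub_cancel_right] using h2
    rcases le_or_gt (m - n) (-1) with h2 | h2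
    · have h3 := h (n + 1, m)
      simp only [latticeRule] at h3
      rw [if_neg (by omega), if_pos (by omega)] at h3
      simpa only [Rule.Holds, QuadCoeff.poly_rotate, add_sub_cancel_right] using h3
    rcases le_or_gt 0 (n + m) with h3 | h3
    · have h4 := h (n + 1, m + 1)
      simp only [latticeRule] at h4
      rw [if_neg (by omega), if_neg (by omega), if_neg (by omega), if_neg (by omega),
        if_neg (by omega), if_neg (by omega), if_pos (by omega)] at h4
      simpa only [Rule.Holds, add_sub_cancel_right] using h4
    · have h4 := h (n, m)
      simp only [latticeRule] at h4
      rw [if_neg (by omega), if_neg (by omega), if_neg (by omega), if_neg (by omega),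
        if_neg (by omega), if_neg (by omega), if_neg (by omega)] at h4
      rw [← QuadCoeff.poly_reverse]
      exact h4
  · rintro ⟨hq, hv⟩ ⟨n, m⟩
    unfold latticeRule
    dsimp only
    split_ifs with h1 h2 h3 h4 h5 h6 h7
    · have h := hq n (m - 1)
      rw [sub_add_cancel] at h
      rwa [Rule.Holds, QuadCoeff.poly_swapLast]
    · have h := hq (n - 1) m
      rw [sub_add_cancel] at h
      rwa [Rule.Holds, QuadCoeff.poly_rotate]
    · obtain rfl : m = n + 1 + 1 := by omega
      have h := (hv (n + 1)).2
      rw [add_sub_cancel_right] at h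
      rw [Rule.Holds, add_sub_cancel_right]
      exact h.symm
    · obtain rfl : n = m + 1 := by omega
      exact (hv m).1.symm
    · trivial
    · trivial
    · have h := hq (n - 1) (m - 1)
      rwa [sub_add_cancel, sub_add_cancel] at h
    · rw [Rule.Holds, QuadCoeff.poly_reverse]
      exact hq n m

theorem twoDegreesOfFreedom_lattice {c : ℤ → ℤ → QuadCoeff} (hc : ∀ n m, (c n m).Nondegenerate) :
    TwoDegreesOfFreedom {v : ℤ × ℤ → ℂ |
      (∀ n m, (c n m).poly (v (n, m)) (v (n + 1, m)) (v (n, m + 1)) (v (n + 1, m + 1)) = 0) ∧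
        Ridge v} (0, 0) (0, 1) := by
  simp only [← latticeRule_holds_iff]
  refine Rule.twoDegreesOfFreedom latticeRank _ (latticeRule_uses hc) ?_ ?_ <;>
  · rintro ⟨n, m⟩
    unfold latticeRule
    dsimp only
    split_ifs <;> simp <;> omega

/-! ### The evolution on the diagonal path -/

/-- The evolution along the diagonal path. -/
def pathRule (c : ℤ → QuadCoeff) (j : ℤ) : Rule ℤ :=
  if j = -1 then .datum 0
  else if j = 0 then .datum 1
  else if 0 < j then .solve (c (j - 1)) (j - 1 - 1) (j - 1) (j - 1)
  else .solve (c (j + 1)) (j + 1 + 1) (j + 1) (j + 1)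

lemma pathRule_uses {c : ℤ → QuadCoeff} (hc : ∀ j, (c j).Nondegenerate) (j : ℤ) :
    (pathRule c j).Uses fun i => (2 * i + 1).natAbs < (2 * j + 1).natAbs := by
  unfold pathRule
  split_ifs with h1 h2 h3
  · trivial
  · trivial
  · refine ⟨hc _, ?_, ?_, ?_⟩ <;> omega
  · refine ⟨hc _, ?_, ?_, ?_⟩ <;> omega

lemma pathRule_holds_iff (c : ℤ → QuadCoeff) (f : ℤ → ℂ) :
    (∀ j, (pathRule c j).Holds f (f j)) ↔
      ∀ j, (c j).poly (f (j - 1)) (f j) (f j) (f (j + 1)) = 0 := by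
  constructor
  · intro h j
    rcases le_or_gt 0 j with h1 | h1
    · have h2 := h (j + 1)
      rw [pathRule, if_neg (by omega), if_neg (by omega), if_pos (by omega)] at h2
      simpa only [Rule.Holds, add_sub_cancel_right] using h2
    · have h2 := h (j - 1)
      rw [pathRule, if_neg (by omega), if_neg (by omega), if_neg (by omega)] at h2
      rw [← QuadCoeff.poly_reverse]
      simpa only [Rule.Holds, sub_add_cancel] using h2
  · intro h j
    unfold pathRule
    split_ifs with h1 h2 h3
    · trivial
    · trivial
    · have h4 := h (j - 1)
      rwa [sub_add_cancel] at h4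
    · have h4 := h (j + 1)
      rw [add_sub_cancel_right] at h4
      rwa [Rule.Holds, QuadCoeff.poly_reverse]

theorem twoDegreesOfFreedom_path {c : ℤ → QuadCoeff} (hc : ∀ j, (c j).Nondegenerate) :
    TwoDegreesOfFreedom {f : ℤ → ℂ | ∀ j, (c j).poly (f (j - 1)) (f j) (f j) (f (j + 1)) = 0}
      (-1) 0 := by
  simp only [← pathRule_holds_iff]
  refine Rule.twoDegreesOfFreedom (fun j : ℤ => (2 * j + 1).natAbs) _ (pathRule_uses hc) ?_ ?_ <;>
  · intro j
    unfold pathRule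
    split_ifs <;> simp <;> omega

/-! ### The lattice system and the second-order equation -/

section Reduction

variable (τ : UpperHalfPlane) (r α₀ β₀ φ : ℂ)

/-- The coefficients of the lattice equation. -/
def latticeCoeff (n m : ℤ) : QuadCoeff :=
  ⟨sn τ (alpha α₀ φ n), -sn τ (beta β₀ φ m), -sn τ (alpha α₀ φ n - beta β₀ φ m),
    modulus τ * sn τ (alpha α₀ φ n) * sn τ (beta β₀ φ m) * sn τ (alpha α₀ φ n - beta β₀ φ m)⟩

lemma Q_eq_poly (n m : ℤ) (w x y z : ℂ) :
    Q τ (alpha α₀ φ n) (beta β₀ φ m) w x y z = (latticeCoeff τ α₀ β₀ φ n m).poly w x y z := by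
  simp only [Q, latticeCoeff, QuadCoeff.poly]
  ring

variable {τ α₀ β₀ φ}

lemma latticeCoeff_nondegenerate (h : LatticeNondegenerate τ α₀ β₀ φ) (n m : ℤ) :
    (latticeCoeff τ α₀ β₀ φ n m).Nondegenerate := by
  obtain ⟨h1, h2, h3⟩ := h n m
  exact ⟨h1, neg_ne_zero.2 h2, neg_ne_zero.2 h3,
    mul_ne_zero (mul_ne_zero (mul_ne_zero (modulus_ne_zero_of_sn_ne_zero τ h1) h1) h2) h3⟩

lemma latticeSolutions_eq : latticeSolutions τ α₀ β₀ φ = {v : ℤ × ℤ → ℂ |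
    (∀ n m, (latticeCoeff τ α₀ β₀ φ n m).poly (v (n, m)) (v (n + 1, m)) (v (n, m + 1))
      (v (n + 1, m + 1)) = 0) ∧ Ridge v} := by
  ext v
  simp only [latticeSolutions, QuadEq, Q_eq_poly]

variable {r}

lemma sqrt_modulus_ne_zero (hr : r ^ 2 = modulus τ)
    (hreg : RcgRegular τ (gammaE α₀ β₀) (gammaO α₀ β₀ φ) (zZero α₀ β₀)) : r ≠ 0 := by
  rintro rfl
  exact modulus_ne_zero_of_sn_ne_zero τ (hreg.2.2 0).2 (by simpa using hr.symm)

lemma rcgEq_even_iff (hr : r ^ 2 = modulus τ) (hfin : LatticeFinite τ α₀ β₀ φ)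
    (hreg : RcgRegular τ (gammaE α₀ β₀) (gammaO α₀ β₀ φ) (zZero α₀ β₀))
    (u : ℤ → ℂ) (n : ℤ) :
    RcgEq τ (gammaE α₀ β₀) (gammaO α₀ β₀ φ) (zZero α₀ β₀) u (2 * n) ↔
      (latticeCoeff τ α₀ β₀ φ n n).poly (r * u (2 * n - 1)) (r * u (2 * n)) (r * u (2 * n))
        (r * u (2 * n + 1)) = 0 := by
  obtain ⟨hge, -, hz⟩ := hreg
  obtain ⟨hz, hsn⟩ := hz (2 * n)
  obtain ⟨ha, hb, hab⟩ := hfin n n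
  have e1 : alpha α₀ φ n = zSeq (gammaE α₀ β₀) (gammaO α₀ β₀ φ) (zZero α₀ β₀) (2 * n) +
      gammaE α₀ β₀ := by
    simp only [alpha, zSeq, gammaE, gammaO, zZero]
    push_cast
    ring
  have e2 : beta β₀ φ n = gammaE α₀ β₀ -
      zSeq (gammaE α₀ β₀) (gammaO α₀ β₀ φ) (zZero α₀ β₀) (2 * n) := by
    simp only [beta, zSeq, gammaE, gammaO, zZero]
    push_cast
    ring
  have eg : gammaSeq (gammaE α₀ β₀) (gammaO α₀ β₀ φ) (2 * n) = gammaE α₀ β₀ :=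
    if_pos (even_two_mul n)
  rw [← Q_eq_poly]
  rw [e1] at ha hab ⊢
  rw [e2] at hb hab ⊢
  rw [Q_fold_iff hr hge hz ha (by rwa [← isPole_neg, neg_sub])
    (by convert hab using 2; ring) hsn]
  unfold RcgEq
  rw [eg]
  rfl

lemma rcgEq_odd_iff (hr : r ^ 2 = modulus τ) (hfin : LatticeFinite τ α₀ β₀ φ)
    (hreg : RcgRegular τ (gammaE α₀ β₀) (gammaO α₀ β₀ φ) (zZero α₀ β₀))
    (u : ℤ → ℂ) (n : ℤ) :
    RcgEq τ (gammaE α₀ β₀) (gammaO α₀ β₀ φ) (zZero α₀ β₀) u (2 * n - 1) ↔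
      (latticeCoeff τ α₀ β₀ φ (n - 1) n).poly (r * u (2 * n - 1 - 1)) (r * u (2 * n - 1))
        (r * u (2 * n - 1)) (r * u (2 * n - 1 + 1)) = 0 := by
  obtain ⟨-, hgo, hz⟩ := hreg
  obtain ⟨hz, hsn⟩ := hz (2 * n - 1)
  obtain ⟨ha, hb, hab⟩ := hfin (n - 1) n
  have e1 : alpha α₀ φ (n - 1) = zSeq (gammaE α₀ β₀) (gammaO α₀ β₀ φ) (zZero α₀ β₀) (2 * n - 1) +
      -gammaO α₀ β₀ φ := by
    simp only [alpha, zSeq, gammaE, gammaO, zZero]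
    push_cast
    ring
  have e2 : beta β₀ φ n = -gammaO α₀ β₀ φ -
      zSeq (gammaE α₀ β₀) (gammaO α₀ β₀ φ) (zZero α₀ β₀) (2 * n - 1) := by
    simp only [beta, zSeq, gammaE, gammaO, zZero]
    push_cast
    ring
  have eg : gammaSeq (gammaE α₀ β₀) (gammaO α₀ β₀ φ) (2 * n - 1) = gammaO α₀ β₀ φ :=
    if_neg (by rw [Int.not_even_iff_odd]; exact ⟨n - 1, by ring⟩)
  rw [← Q_eq_poly]
  rw [e1] at ha hab ⊢
  rw [e2] at hb hab ⊢
  -- At odd indices the fold parameter is $g=-\gamma_o$; its sign is immaterial because `rcgPoly` is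
  -- even in $g$.
  rw [Q_fold_iff hr (by rwa [isPole_neg]) hz ha (by rwa [← isPole_neg, neg_sub])
    (by convert hab using 2; ring) hsn, rcgPoly_neg]
  unfold RcgEq
  rw [eg]
  rfl

lemma rcgEq_iff (hr : r ^ 2 = modulus τ) (hfin : LatticeFinite τ α₀ β₀ φ)
    (hreg : RcgRegular τ (gammaE α₀ β₀) (gammaO α₀ β₀ φ) (zZero α₀ β₀))
    (u : ℤ → ℂ) (j : ℤ) :
    RcgEq τ (gammaE α₀ β₀) (gammaO α₀ β₀ φ) (zZero α₀ β₀) u j ↔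
      (latticeCoeff τ α₀ β₀ φ (j / 2) ((j + 1) / 2)).poly (r * u (j - 1)) (r * u j) (r * u j)
        (r * u (j + 1)) = 0 := by
  rcases Int.even_or_odd' j with ⟨n, rfl | rfl⟩
  · rw [rcgEq_even_iff hr hfin hreg, show 2 * n / 2 = n by omega,
      show (2 * n + 1) / 2 = n by omega]
  · have h := rcgEq_odd_iff hr hfin hreg u (n + 1)
    rw [show 2 * (n + 1) - 1 = 2 * n + 1 by ring, add_sub_cancel_right] at h
    rw [h, show (2 * n + 1) / 2 = n by omega, show (2 * n + 1 + 1) / 2 = n + 1 by omega]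

theorem twoDegreesOfFreedom_rcg (hr : r ^ 2 = modulus τ) (hfin : LatticeFinite τ α₀ β₀ φ)
    (hreg : RcgRegular τ (gammaE α₀ β₀) (gammaO α₀ β₀ φ) (zZero α₀ β₀))
    (hnd : LatticeNondegenerate τ α₀ β₀ φ) :
    TwoDegreesOfFreedom
      (rcgSolutions τ (gammaE α₀ β₀) (gammaO α₀ β₀ φ) (zZero α₀ β₀)) (-1) 0 := by
  have h := (twoDegreesOfFreedom_path (c := fun j =>
    latticeCoeff τ α₀ β₀ φ (j / 2) ((j + 1) / 2)) fun j =>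
      latticeCoeff_nondegenerate hnd _ _).rescale (sqrt_modulus_ne_zero hr hreg)
  simpa only [rcgSolutions, rcgEq_iff hr hfin hreg] using! h

end Reduction

lemma mul_pathVar_even {r : ℂ} (hr : r ≠ 0) (v : ℤ × ℤ → ℂ) (n : ℤ) :
    r * pathVar r v (2 * n) = v (n, n + 1) := by
  rw [pathVar, if_pos (even_two_mul n), mul_div_cancel₀ _ hr, show 2 * n / 2 = n by omega]

lemma mul_pathVar_odd {r : ℂ} (hr : r ≠ 0) (v : ℤ × ℤ → ℂ) (n : ℤ) :
    r * pathVar r v (2 * n - 1) = v (n, n) := by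
  rw [pathVar, if_neg (by rw [Int.not_even_iff_odd]; exact ⟨n - 1, by ring⟩),
    mul_div_cancel₀ _ hr, show (2 * n - 1 + 1) / 2 = n by omega]

/-! ### Restriction to the diagonal path and generic lifting. -/

section Coincidence

variable {τ : UpperHalfPlane} {r α₀ β₀ φ : ℂ}

lemma quadEq_iff_rcgEq_even (hr : r ^ 2 = modulus τ) (hfin : LatticeFinite τ α₀ β₀ φ)
    (hreg : RcgRegular τ (gammaE α₀ β₀) (gammaO α₀ β₀ φ) (zZero α₀ β₀))
    {v : ℤ × ℤ → ℂ} (hv : Ridge v) (n : ℤ) :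
    QuadEq τ α₀ β₀ φ v n n ↔
      RcgEq τ (gammaE α₀ β₀) (gammaO α₀ β₀ φ) (zZero α₀ β₀) (pathVar r v) (2 * n) := by
  have h0 := sqrt_modulus_ne_zero hr hreg
  have h1 := mul_pathVar_odd h0 v (n + 1)
  rw [show 2 * (n + 1) - 1 = 2 * n + 1 by ring] at h1
  rw [rcgEq_even_iff hr hfin hreg, mul_pathVar_even h0, mul_pathVar_odd h0, h1, QuadEq, Q_eq_poly,
    (hv n).1]

lemma quadEq_iff_rcgEq_odd (hr : r ^ 2 = modulus τ) (hfin : LatticeFinite τ α₀ β₀ φ)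
    (hreg : RcgRegular τ (gammaE α₀ β₀) (gammaO α₀ β₀ φ) (zZero α₀ β₀))
    {v : ℤ × ℤ → ℂ} (hv : Ridge v) (n : ℤ) :
    QuadEq τ α₀ β₀ φ v (n - 1) n ↔
      RcgEq τ (gammaE α₀ β₀) (gammaO α₀ β₀ φ) (zZero α₀ β₀) (pathVar r v) (2 * n - 1) := by
  have h0 := sqrt_modulus_ne_zero hr hreg
  have h1 := mul_pathVar_even h0 v (n - 1)
  rw [show 2 * (n - 1) = 2 * n - 1 - 1 by ring, sub_add_cancel] at h1
  rw [rcgEq_odd_iff hr hfin hreg, sub_add_cancel, mul_pathVar_even h0, mul_pathVar_odd h0, h1,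
    QuadEq, Q_eq_poly, sub_add_cancel, (hv n).2]

theorem pathVar_mem_rcgSolutions (hr : r ^ 2 = modulus τ) (hfin : LatticeFinite τ α₀ β₀ φ)
    (hreg : RcgRegular τ (gammaE α₀ β₀) (gammaO α₀ β₀ φ) (zZero α₀ β₀))
    {v : ℤ × ℤ → ℂ} (hv : v ∈ latticeSolutions τ α₀ β₀ φ) :
    pathVar r v ∈ rcgSolutions τ (gammaE α₀ β₀) (gammaO α₀ β₀ φ) (zZero α₀ β₀) := by
  intro j
  rcases Int.even_or_odd' j with ⟨n, rfl | rfl⟩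
  · exact (quadEq_iff_rcgEq_even hr hfin hreg hv.2 n).1 (hv.1 n n)
  · rw [show 2 * n + 1 = 2 * (n + 1) - 1 by ring]
    exact (quadEq_iff_rcgEq_odd hr hfin hreg hv.2 (n + 1)).1 (hv.1 _ _)

theorem exists_generic_lift (hr : r ^ 2 = modulus τ) (hfin : LatticeFinite τ α₀ β₀ φ)
    (hreg : RcgRegular τ (gammaE α₀ β₀) (gammaO α₀ β₀ φ) (zZero α₀ β₀))
    (hnd : LatticeNondegenerate τ α₀ β₀ φ) :
    ∃ E : ℕ → MvPolynomial (Fin 2) ℂ, (∀ l, E l ≠ 0) ∧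
      ∀ u ∈ rcgSolutions τ (gammaE α₀ β₀) (gammaO α₀ β₀ φ) (zZero α₀ β₀),
        Avoids E (u (-1)) (u 0) →
          ∃! v : ℤ × ℤ → ℂ, v ∈ latticeSolutions τ α₀ β₀ φ ∧ pathVar r v = u := by
  have h0 := sqrt_modulus_ne_zero hr hreg
  have hlat := twoDegreesOfFreedom_lattice (latticeCoeff_nondegenerate hnd)
  rw [← latticeSolutions_eq] at hlat
  obtain ⟨E₁, N₁, D₁, hE₁, h₁⟩ := hlat.rescale h0
  obtain ⟨E₂, N₂, D₂, hE₂, h₂⟩ := twoDegreesOfFreedom_rcg hr hfin hreg hnd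
  have hodd (v : ℤ × ℤ → ℂ) : pathVar r v (-1) = v (0, 0) / r := by
    rw [eq_div_iff h0, mul_comm]
    simpa using mul_pathVar_odd h0 v 0
  have heven (v : ℤ × ℤ → ℂ) : pathVar r v 0 = v (0, 1) / r := by
    rw [eq_div_iff h0, mul_comm]
    simpa using mul_pathVar_even h0 v 0
  -- The products avoid zero exactly where both families do, so existence on the lattice and
  -- uniqueness on the path are available together.
  refine ⟨fun l => E₁ l * E₂ l, fun l => mul_ne_zero (hE₁ l) (hE₂ l), fun u hu hE => ?_⟩
  have hA₁ : Avoids E₁ (u (-1)) (u 0) := fun l => by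
    have h := hE l
    rw [map_mul] at h
    exact left_ne_zero_of_mul h
  have hA₂ : Avoids E₂ (u (-1)) (u 0) := fun l => by
    have h := hE l
    rw [map_mul] at h
    exact right_ne_zero_of_mul h
  obtain ⟨w, hwdef⟩ : ∃ w : ℤ × ℤ → ℂ, w = fun s => MvPolynomial.eval ![u (-1), u 0] (N₁ s) /
    MvPolynomial.eval ![u (-1), u 0] (D₁ s) := ⟨_, rfl⟩
  obtain ⟨hw, hw0, hw1⟩ := ((h₁ _ _ hA₁).2 w).2 hwdef
  refine ⟨fun s => r * w s, ⟨hw, ?_⟩, ?_⟩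
  · rw [((h₂ _ _ hA₂).2 u).1 ⟨hu, rfl, rfl⟩]
    refine ((h₂ _ _ hA₂).2 _).1 ⟨pathVar_mem_rcgSolutions hr hfin hreg hw, ?_, ?_⟩
    · rw [hodd, hw0, mul_div_cancel_left₀ _ h0]
    · rw [heven, hw1, mul_div_cancel_left₀ _ h0]
  · rintro v ⟨hv, rfl⟩
    have h := ((h₁ _ _ hA₁).2 fun s => v s / r).1
      ⟨by simpa only [Set.mem_ofPred_eq, mul_div_cancel₀ _ h0] using hv,
        (hodd v).symm, (heven v).symm⟩
    rw [hwdef, ← h]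
    funext s
    exact (mul_div_cancel₀ _ h0).symm

end Coincidence

end Q4Red

end

theorem mainTheorem4 (τ : UpperHalfPlane) (r : ℂ) (hr : r ^ 2 = Q4Red.modulus τ)
    (α₀ β₀ φ : ℂ) (hfin : Q4Red.LatticeFinite τ α₀ β₀ φ) :
    -- the constrained lattice system has two degrees of freedom
    (Q4Red.LatticeNondegenerate τ α₀ β₀ φ →
      Q4Red.TwoDegreesOfFreedom (Q4Red.latticeSolutions τ α₀ β₀ φ) (0, 0) (0, 1)) ∧
    -- along the diagonal path it coincides with the second-order equation
    (Q4Red.RcgRegular τ (Q4Red.gammaE α₀ β₀) (Q4Red.gammaO α₀ β₀ φ) (Q4Red.zZero α₀ β₀) →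
      (∀ v ∈ Q4Red.latticeSolutions τ α₀ β₀ φ,
        Q4Red.pathVar r v ∈ Q4Red.rcgSolutions τ
          (Q4Red.gammaE α₀ β₀) (Q4Red.gammaO α₀ β₀ φ) (Q4Red.zZero α₀ β₀)) ∧
      (∀ v : ℤ × ℤ → ℂ, Q4Red.Ridge v → ∀ n : ℤ,
        (Q4Red.QuadEq τ α₀ β₀ φ v n n ↔
          Q4Red.RcgEq τ (Q4Red.gammaE α₀ β₀) (Q4Red.gammaO α₀ β₀ φ) (Q4Red.zZero α₀ β₀)
            (Q4Red.pathVar r v) (2 * n)) ∧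
        (Q4Red.QuadEq τ α₀ β₀ φ v (n - 1) n ↔
          Q4Red.RcgEq τ (Q4Red.gammaE α₀ β₀) (Q4Red.gammaO α₀ β₀ φ) (Q4Red.zZero α₀ β₀)
            (Q4Red.pathVar r v) (2 * n - 1))) ∧
      (Q4Red.LatticeNondegenerate τ α₀ β₀ φ →
        Q4Red.TwoDegreesOfFreedom (Q4Red.rcgSolutions τ
          (Q4Red.gammaE α₀ β₀) (Q4Red.gammaO α₀ β₀ φ) (Q4Red.zZero α₀ β₀)) (-1) 0 ∧
        ∃ E : ℕ → MvPolynomial (Fin 2) ℂ, (∀ l, E l ≠ 0) ∧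
          ∀ u ∈ Q4Red.rcgSolutions τ
              (Q4Red.gammaE α₀ β₀) (Q4Red.gammaO α₀ β₀ φ) (Q4Red.zZero α₀ β₀),
            Q4Red.Avoids E (u (-1)) (u 0) →
              ∃! v : ℤ × ℤ → ℂ, v ∈ Q4Red.latticeSolutions τ α₀ β₀ φ ∧
                Q4Red.pathVar r v = u)) := by
  open Q4Red in
  refine ⟨fun hnd => ?_, fun hreg => ⟨fun v hv => pathVar_mem_rcgSolutions hr hfin hreg hv,
    fun v hv n => ⟨quadEq_iff_rcgEq_even hr hfin hreg hv n, quadEq_iff_rcgEq_odd hr hfin hreg hv n⟩,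
    fun hnd => ⟨twoDegreesOfFreedom_rcg hr hfin hreg hnd,
      exists_generic_lift hr hfin hreg hnd⟩⟩⟩
  rw [Q4Red.latticeSolutions_eq]
  exact Q4Red.twoDegreesOfFreedom_lattice (Q4Red.latticeCoeff_nondegenerate hnd)
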